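/- Let $\mathbb{N}=\{1,2,3,\dots\}$. For a sequence $\langle x_n\rangle_{n\in\mathbb N}$ in $\mathbb{N}$ let $$FEX(\langle x_n\rangle_n)=\left\{x_{i_k}^{x_{i_{k-1}}^{\cdot^{\cdot^{\cdot^{x_{i_1}}}}}} : k\in\mathbb{N},\ 1\le i_1<i_2<\cdots<i_k\right\}$$ be the Hindman tower generated by it (power towers are evaluated from the top down; for $k=1$ the tower is $x_{i_1}$), and for a sequence $\langle y_n\rangle_{n\in\mathbb N}$ in $\mathbb{N}$ let $$FP(\langle y_n\rangle_n)=\left\{\prod_{t\in H}y_t : H\subseteq\mathbb{N}\text{ finite and nonempty}\right\}.$$ **Theorem 4.8.** For every finite partition of $\mathbb{N}$ there exist two injective sequences $\langle x_n\rangle_n$ and $\langle y_n\rangle_n$ in $\mathbb{N}$ such that $FEX(\langle x_n\rangle_n)\cup FP(\langle y_n\rangle_n)$ is monochromatic, i.e. is contained in a single cell of the partition. -/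

import Mathlib

namespace ExpHindman

/-- The power tower `a n ^ (a (n-1) ^ ( ⋯ ^ (a 1 ^ a 0)))` of positive integers, with `a 0` on top
and `a n` at the bottom. -/
def tower (a : ℕ → ℕ+) : ℕ → ℕ+
  | 0 => a 0
  | n + 1 => a (n + 1) ^ (tower a n : ℕ)

/-- The Hindman tower generated by the sequence `x`: all power towers
`x (i n) ^ (x (i (n-1)) ^ ( ⋯ ^ x (i 0)))` over nonempty finite strings of indices
`i 0 < i 1 < ⋯ < i n`. (Only the values of `i` on `{0, …, n}` matter.) -/
def FEX (x : ℕ → ℕ+) : Set ℕ+ :=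
  {t | ∃ (n : ℕ) (i : ℕ → ℕ), StrictMonoOn i (Set.Iic n) ∧ t = tower (fun k => x (i k)) n}

/-- The set of all products of the terms of `y` over nonempty finite sets of indices. -/
def FP (y : ℕ → ℕ+) : Set ℕ+ :=
  {t | ∃ H : Finset ℕ, H.Nonempty ∧ t = ∏ j ∈ H, y j}

end ExpHindman

/-!
Put `x n = 2 ^ a n` and `y n = 2 ^ b n`. Since `(2 ^ b) ^ (2 ^ t) = 2 ^ (2 ^ t * b)`, it suffices,
for every finite cover of `ℕ`, to find a part `A` which contains all finite sums of an injective
sequence `b`, and an injective sequence `a` all of whose *logarithmic towers*, formed by iterating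
`(t, b) ↦ 2 ^ t * b`, lie in `A`.

Let `f` be the map induced on the space `Ultrafilter ℕ` by doubling. Choose an idempotent `U` for
addition, a minimal closed `f`-invariant set `Y` in the orbit closure of `U`
(`exists_minimal_orbit_closure`), and a part `A` that belongs to some member of `Y`. Any set `C` in
a member of `Y` has two properties.

* `C` belongs to some `f^[m] U`. As multiplication by `2 ^ m` is additive, `f^[m] U` is again
  idempotent, so `C` contains all finite sums of some strictly increasing sequence
  (`exists_strictMono_finset_sum_mem`).
* `C` is multiply recurrent along finite sums: for finite `S ⊆ ℕ` and every sequence `b` there are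
  a finite sum `d` of terms of `b` and `q ∈ Y` such that `C ∈ f^[s * d] q` for all `s ∈ S`
  (`exists_forall_iterate_mem`, a van der Waerden theorem deduced from the Hales–Jewett theorem).

The sequence `a` is chosen recursively. Let `T` be the finite set of the logarithmic towers built so
far, and suppose that `C = {c ∈ A | ∀ t ∈ T, 2 ^ t * c ∈ A}` belongs to a member of `Y`. Feeding the
sequence from the first property into the second, with `S = {0, 1} ∪ {2 ^ t | t ∈ T}`, gives a large
`d ∈ C` and `q ∈ Y` such that `q` contains `C` and all sets `{c | 2 ^ (s * d) * c ∈ C}`, `s ∈ S`.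
Then `d` is a legitimate next term because `d ∈ C`, and the hypothesis is inherited by
`T ∪ {d} ∪ {2 ^ t * d | t ∈ T}` because `C ⊆ A` (`exists_extension`).
-/

namespace ExpHindman

open Set Filter

/-! ### Finite sums in idempotent ultrafilters -/

attribute [local instance] Ultrafilter.addSemigroup

theorem exists_idempotent_eventually_pos :
    ∃ U : Ultrafilter ℕ, U + U = U ∧ ∀ᶠ n in U, 0 < n := by
  obtain ⟨U, hU, hpos⟩ := Hindman.exists_idempotent_ultrafilter_le_FS (fun _ => 1 : Stream' ℕ)
  refine ⟨U, hU, hpos.mono fun m hm => ?_⟩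
  suffices ∀ a : Stream' ℕ, ∀ m ∈ Hindman.FS a, (∀ n, 0 < a n) → 0 < m from
    this _ m hm fun _ => one_pos
  intro a m hm
  induction hm with
  | head' a => exact fun h => h 0
  | tail' a m _ ih => exact fun h => ih fun n => h (n + 1)
  | cons' a m _ ih => exact fun h => Nat.add_pos_left (h 0) _

theorem map_mul_left_add_self {U : Ultrafilter ℕ} (hU : U + U = U) (k : ℕ) :
    U.map (k * ·) + U.map (k * ·) = U.map (k * ·) := by
  refine Ultrafilter.coe_inj.mp (Filter.ext' fun p => ?_)
  rw [Ultrafilter.eventually_add]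
  simp only [Ultrafilter.coe_map, Filter.eventually_map, ← mul_add]
  rw [← Ultrafilter.eventually_add U U fun n => p (k * n), hU]

/-- The terms of the sequence are sums over consecutive blocks of the sequence provided by
Hindman's theorem, each block being longer than the sum of all earlier ones. -/
theorem exists_strictMono_finset_sum_mem {U : Ultrafilter ℕ} (hU : U + U = U)
    (hpos : ∀ᶠ n in U, 0 < n) {s : Set ℕ} (hs : s ∈ U) :
    ∃ b : ℕ → ℕ, StrictMono b ∧ ∀ H : Finset ℕ, H.Nonempty → ∑ k ∈ H, b k ∈ s := by
  obtain ⟨a, ha⟩ := Hindman.exists_FS_of_large U hU (s ∩ {n | 0 < n}) (inter_mem hs hpos)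
  have ha' : ∀ H : Finset ℕ, H.Nonempty → ∑ k ∈ H, a.get k ∈ s ∩ {n | 0 < n} := fun H hH =>
    ha (Hindman.FS.finsetSum a H hH)
  have ha1 : ∀ k, 1 ≤ a.get k := fun k => by
    simpa [Nat.one_le_iff_ne_zero, Nat.pos_iff_ne_zero] using
      (ha' {k} (Finset.singleton_nonempty k)).2
  let p : ℕ → ℕ := fun n =>
    Nat.rec 0 (fun _ m => m + ∑ k ∈ Finset.range m, a.get k + 1) n
  have hp : ∀ n, p (n + 1) = p n + ∑ k ∈ Finset.range (p n), a.get k + 1 := fun n => rfl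
  have hpm : StrictMono p := strictMono_nat_of_lt_succ fun n => by rw [hp]; omega
  refine ⟨fun n => ∑ k ∈ Finset.Ico (p n) (p (n + 1)), a.get k,
    strictMono_nat_of_lt_succ fun n => ?_, fun H hH => ?_⟩
  · calc ∑ k ∈ Finset.Ico (p n) (p (n + 1)), a.get k
        ≤ ∑ k ∈ Finset.range (p (n + 1)), a.get k :=
          Finset.sum_le_sum_of_subset fun k hk => by simp at hk ⊢; omega
      _ < p (n + 2) - p (n + 1) := by rw [hp (n + 1)]; omega
      _ = ∑ k ∈ Finset.Ico (p (n + 1)) (p (n + 2)), 1 := by simp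
      _ ≤ _ := Finset.sum_le_sum fun k _ => ha1 k
  · rw [← Finset.sum_biUnion]
    · refine (ha' _ ?_).1
      obtain ⟨n, hn⟩ := hH
      exact ⟨p n, Finset.mem_biUnion.2 ⟨n, hn, by simp [hpm n.lt_succ_self]⟩⟩
    · intro m _ n _ hmn
      have key : ∀ {m n : ℕ}, m < n →
          Disjoint (Finset.Ico (p m) (p (m + 1))) (Finset.Ico (p n) (p (n + 1))) := by
        intro m n h
        have := hpm.monotone (Nat.succ_le_of_lt h)
        refine Finset.disjoint_left.2 fun k hk hk' => ?_
        simp only [Finset.mem_Ico, Nat.succ_eq_add_one] at *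
        omega
      rcases lt_or_gt_of_ne hmn with h | h
      · exact key h
      · exact (key h).symm

/-! ### Minimal systems and multiple recurrence along finite sums -/

section Dynamics

variable {X : Type*} [TopologicalSpace X] [CompactSpace X] {f : X → X}

/-- The orbit closure of a point contains a minimal closed invariant set: one in which every orbit
is dense. -/
theorem exists_minimal_orbit_closure (hf : Continuous f) (x : X) :
    ∃ Y : Set X, Y ⊆ closure (range fun n => f^[n] x) ∧ IsClosed Y ∧ Y.Nonempty ∧ MapsTo f Y Y ∧
      ∀ q ∈ Y, Y ⊆ closure (range fun n => f^[n] q) := by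
  let S : Set (Set X) := {Y | IsClosed Y ∧ Y.Nonempty ∧ MapsTo f Y Y}
  have horb : ∀ q, closure (range fun n => f^[n] q) ∈ S := fun q => by
    refine ⟨isClosed_closure, ⟨_, subset_closure ⟨0, rfl⟩⟩, MapsTo.closure ?_ hf⟩
    rintro _ ⟨n, rfl⟩
    exact ⟨n + 1, Function.iterate_succ_apply' f n q⟩
  obtain ⟨Y, hYx, hY⟩ := zorn_superset_nonempty S (fun c hcS hc hne => by
    refine ⟨⋂₀ c, ⟨isClosed_sInter fun s hs => (hcS hs).1, ?_, fun y hy s hs =>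
      (hcS hs).2.2 (hy s hs)⟩, fun s hs => sInter_subset_of_mem hs⟩
    have : Nonempty c := hne.to_subtype
    exact IsCompact.nonempty_sInter_of_directed_nonempty_isCompact_isClosed
      (IsChain.directedOn hc.symm) (fun s hs => (hcS hs).2.1)
      (fun s hs => (hcS hs).1.isCompact) (fun s hs => (hcS hs).1)) _ (horb x)
  refine ⟨Y, hYx, hY.prop.1, hY.prop.2.1, hY.prop.2.2, fun q hq => hY.le_of_le (horb q) ?_⟩
  refine closure_minimal ?_ hY.prop.1
  rintro _ ⟨n, rfl⟩
  exact hY.prop.2.2.iterate n hq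

/-- Multiple recurrence in a minimal system, with a return time in a prescribed set of finite
sums. -/
theorem exists_forall_iterate_mem (hf : Continuous f) {Y : Set X} (hYc : IsClosed Y)
    (hYf : MapsTo f Y Y) (hYm : ∀ q ∈ Y, Y ⊆ closure (range fun n => f^[n] q))
    {V : Set X} (hV : IsOpen V) (hVY : (Y ∩ V).Nonempty) (S : Finset ℕ) (b : ℕ → ℕ) :
    ∃ H : Finset ℕ, H.Nonempty ∧ ∃ q ∈ Y, ∀ s ∈ S, f^[s * ∑ k ∈ H, b k] q ∈ V := by
  classical
  obtain ⟨v, hvY, hvV⟩ := hVY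
  -- By compactness every point of `Y` enters `V` at one of finitely many times.
  obtain ⟨J, hJ⟩ := hYc.isCompact.elim_finite_subcover (fun j => f^[j] ⁻¹' V)
    (fun j => hV.preimage (hf.iterate j)) fun q hq => by
      obtain ⟨_, hz, j, rfl⟩ := mem_closure_iff.1 (hYm q hq hvY) V hV hvV
      exact mem_iUnion.2 ⟨j, hz⟩
  have hent : ∀ n, ∃ j : J, f^[j + n] v ∈ V := fun n => by
    obtain ⟨j, hj, h⟩ := mem_iUnion₂.1 (hJ (hYf.iterate n hvY))
    exact ⟨⟨j, hj⟩, by rwa [Function.iterate_add_apply]⟩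
  choose col hcol using hent
  -- Colour a word `w` over the alphabet `S` by an entrance time of the point reached from `v` after
  -- `∑ w i * b i` steps.
  obtain ⟨ι, _, hHJ⟩ := Combinatorics.Line.exists_mono_in_high_dimension S J
  let e := Fintype.equivFin ι
  obtain ⟨l, c, hl⟩ := hHJ fun w => col (∑ i, (w i : ℕ) * b (e i))
  let φ : ι ↪ ℕ := e.toEmbedding.trans Fin.valEmbedding
  let I : Finset ι := Finset.univ.filter fun i => l.idxFun i = none
  let r : ℕ := ∑ i, (l.idxFun i).elim 0 fun s => (s : ℕ) * b (e i)
  refine ⟨I.map φ, ?_, f^[c + r] v, hYf.iterate _ hvY, fun s hs => ?_⟩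
  · obtain ⟨i, hi⟩ := l.proper
    exact Finset.Nonempty.map ⟨i, by simp [I, hi]⟩
  · have h := hcol (∑ i, (l ⟨s, hs⟩ i : ℕ) * b (e i))
    rw [show col _ = c from hl ⟨s, hs⟩] at h
    have hsum : ∑ i, (l ⟨s, hs⟩ i : ℕ) * b (e i) = s * ∑ k ∈ I.map φ, b k + r := by
      rw [Finset.sum_map, Finset.mul_sum, Finset.sum_filter, ← Finset.sum_add_distrib]
      refine Finset.sum_congr rfl fun i _ => ?_
      cases hi : l.idxFun i <;> simp [hi, φ]
    rw [← Function.iterate_add_apply]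
    convert h using 2
    rw [hsum]
    ring

end Dynamics

/-! ### Doubling on the space of ultrafilters -/

/-- The map induced on ultrafilters by `n ↦ 2 * n`. -/
def double (U : Ultrafilter ℕ) : Ultrafilter ℕ := U.map (2 * ·)

theorem continuous_double : Continuous double :=
  ultrafilterBasis_is_basis.continuous_iff.2 <| forall_mem_range.mpr fun s =>
    ultrafilter_isOpen_basic ((2 * ·) ⁻¹' s)

theorem iterate_double (U : Ultrafilter ℕ) (n : ℕ) : double^[n] U = U.map (2 ^ n * ·) := by
  induction n with
  | zero => simp
  | succ n ih =>
    rw [Function.iterate_succ_apply', ih, double, Ultrafilter.map_map]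
    congr 1
    funext m
    simp only [Function.comp_apply]
    ring

theorem mem_iterate_double {U : Ultrafilter ℕ} {n : ℕ} {s : Set ℕ} :
    s ∈ double^[n] U ↔ ∀ᶠ c in U, 2 ^ n * c ∈ s := by
  rw [iterate_double]
  rfl

theorem exists_strictMono_finset_sum_mem_of_mem_orbit_closure {U q : Ultrafilter ℕ}
    (hU : U + U = U) (hpos : ∀ᶠ n in U, 0 < n)
    (hq : q ∈ closure (range fun n => double^[n] U)) {s : Set ℕ} (hs : s ∈ q) :
    ∃ b : ℕ → ℕ, StrictMono b ∧ ∀ H : Finset ℕ, H.Nonempty → ∑ k ∈ H, b k ∈ s := by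
  obtain ⟨_, hm, m, rfl⟩ := mem_closure_iff.1 hq _ (ultrafilter_isOpen_basic s) hs
  refine exists_strictMono_finset_sum_mem (U := double^[m] U) ?_ ?_ hm
  · rw [iterate_double]
    exact map_mul_left_add_self hU _
  · exact mem_iterate_double.2 (hpos.mono fun n hn => Nat.mul_pos (by positivity) hn)

/-! ### The recursive construction -/

/-- `Extendable Y A T` says that the finite set `T` lies in `A` and that some ultrafilter in `Y`
contains the set of all `c ∈ A` with `2 ^ t * c ∈ A` for every `t ∈ T`. -/
def Extendable (Y : Set (Ultrafilter ℕ)) (A : Set ℕ) (T : Finset ℕ) : Prop :=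
  ↑T ⊆ A ∧ ∃ q ∈ Y, {c | c ∈ A ∧ ∀ t ∈ T, 2 ^ t * c ∈ A} ∈ q

/-- The set of logarithmic towers after adjoining the term `d` to a sequence whose logarithmic
towers form the set `T`. -/
def adjoin (T : Finset ℕ) (d : ℕ) : Finset ℕ :=
  insert d (T ∪ T.image fun t => 2 ^ t * d)

theorem exists_extension {U : Ultrafilter ℕ} (hU : U + U = U) (hpos : ∀ᶠ n in U, 0 < n)
    {Y : Set (Ultrafilter ℕ)} (hYU : Y ⊆ closure (range fun n => double^[n] U))
    (hYc : IsClosed Y) (hYf : MapsTo double Y Y)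
    (hYm : ∀ q ∈ Y, Y ⊆ closure (range fun n => double^[n] q)) {A : Set ℕ} {T : Finset ℕ}
    (hT : Extendable Y A T) : ∃ d, (∀ t ∈ T, t < d) ∧ Extendable Y A (adjoin T d) := by
  obtain ⟨hTA, q, hqY, hq⟩ := hT
  set C := {c | c ∈ A ∧ ∀ t ∈ T, 2 ^ t * c ∈ A} with hC
  obtain ⟨b, hb, hbC⟩ :=
    exists_strictMono_finset_sum_mem_of_mem_orbit_closure hU hpos (hYU hqY) hq
  -- Dropping the first terms of `b` makes every finite sum larger than all elements of `T`.
  let N := T.sup id + 1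
  obtain ⟨H, hH, r, hrY, hr⟩ := exists_forall_iterate_mem continuous_double hYc hYf hYm
    (ultrafilter_isOpen_basic C) ⟨q, hqY, hq⟩ (insert 0 (insert 1 (T.image (2 ^ ·))))
    fun k => b (k + N)
  have hdC : ∑ k ∈ H, b (k + N) ∈ C := by
    have := hbC (H.map (addRightEmbedding N)) (hH.map)
    rwa [Finset.sum_map] at this
  have hdN : N ≤ ∑ k ∈ H, b (k + N) := by
    obtain ⟨k, hk⟩ := hH
    calc N ≤ k + N := by omega
      _ ≤ b (k + N) := hb.le_apply
      _ ≤ _ := Finset.single_le_sum (f := fun k => b (k + N)) (fun _ _ => Nat.zero_le _) hk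
  generalize ∑ k ∈ H, b (k + N) = d at hr hdC hdN
  have hr0 : ∀ᶠ c in r, c ∈ C := by
    simpa using mem_iterate_double.1 (hr 0 (by simp))
  have hr1 : ∀ᶠ c in r, 2 ^ d * c ∈ C := by
    simpa using mem_iterate_double.1 (hr 1 (by simp))
  have hrT : ∀ᶠ c in r, ∀ t ∈ T, 2 ^ (2 ^ t * d) * c ∈ C :=
    (Filter.eventually_all_finset T).2 fun t ht =>
      mem_iterate_double.1 <| hr (2 ^ t) <| by
        rw [Finset.mem_insert, Finset.mem_insert, Finset.mem_image]
        exact .inr (.inr ⟨t, ht, rfl⟩)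
  refine ⟨d, fun t ht => (Nat.lt_succ_of_le (Finset.le_sup (f := id) ht)).trans_le hdN,
    fun u hu => ?_, r, hrY, ?_⟩
  · simp only [adjoin, Finset.coe_insert, Finset.coe_union, Finset.coe_image, mem_insert_iff,
      mem_union, mem_image, Finset.mem_coe] at hu
    rcases hu with rfl | hu | ⟨t, ht, rfl⟩
    exacts [hdC.1, hTA hu, hdC.2 t ht]
  · filter_upwards [hr0, hr1, hrT] with c h0 h1 h2
    refine ⟨h0.1, fun u hu => ?_⟩
    simp only [adjoin, Finset.mem_insert, Finset.mem_union, Finset.mem_image] at hu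
    rcases hu with rfl | hu | ⟨t, ht, rfl⟩
    exacts [h1.1, h0.2 u hu, (h2 t ht).1]

/-! ### Logarithmic towers -/

/-- The base-two logarithm of the tower of the sequence `2 ^ a 0, …, 2 ^ a n`. -/
def logTower (a : ℕ → ℕ) : ℕ → ℕ
  | 0 => a 0
  | n + 1 => 2 ^ logTower a n * a (n + 1)

theorem tower_two_pow (a : ℕ → ℕ) (n : ℕ) :
    tower (fun k => 2 ^ a k) n = 2 ^ logTower a n := by
  induction n with
  | zero => rfl
  | succ n ih =>
    rw [tower, ih, logTower, ← pow_mul, mul_comm]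
    simp

theorem logTower_mem {a : ℕ → ℕ} {T : ℕ → Finset ℕ} (hT : ∀ n, T (n + 1) = adjoin (T n) (a n))
    {i : ℕ → ℕ} {n : ℕ} (hi : StrictMonoOn i (Iic n)) :
    logTower (fun k => a (i k)) n ∈ T (i n + 1) := by
  have hmono : Monotone T := monotone_nat_of_le_succ fun n u hu => by
    simp [hT, adjoin, hu]
  induction n with
  | zero => simp [hT, adjoin, logTower]
  | succ n ih =>
    have h := hmono (Nat.succ_le_of_lt (hi (mem_Iic.2 n.le_succ) (mem_Iic.2 le_rfl) n.lt_succ_self))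
      (ih (hi.mono (Iic_subset_Iic.2 n.le_succ)))
    rw [hT, adjoin, Finset.mem_insert, Finset.mem_union, Finset.mem_image]
    exact .inr (.inr ⟨_, h, rfl⟩)

/-- The additive form of the theorem, for the exponents of powers of two. -/
theorem exists_logTower_mem_and_sum_mem {ι : Type*} [Finite ι] (A : ι → Set ℕ)
    (hA : ∀ n, ∃ i, n ∈ A i) :
    ∃ j, ∃ a b : ℕ → ℕ, Function.Injective a ∧ Function.Injective b ∧
      (∀ (n : ℕ) (i : ℕ → ℕ), StrictMonoOn i (Iic n) → logTower (fun k => a (i k)) n ∈ A j) ∧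
      ∀ H : Finset ℕ, H.Nonempty → ∑ k ∈ H, b k ∈ A j := by
  obtain ⟨U, hU, hpos⟩ := exists_idempotent_eventually_pos
  obtain ⟨Y, hYU, hYc, ⟨q, hqY⟩, hYf, hYm⟩ := exists_minimal_orbit_closure continuous_double U
  obtain ⟨j, hj⟩ : ∃ j, A j ∈ q := by
    have : ∀ᶠ n in (q : Filter ℕ), ∃ i, n ∈ A i := Eventually.of_forall hA
    exact Ultrafilter.eventually_exists_iff.1 this
  obtain ⟨b, hb, hbA⟩ :=
    exists_strictMono_finset_sum_mem_of_mem_orbit_closure hU hpos (hYU hqY) hj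
  choose! next hlt hnext using fun (T : Finset ℕ) (hT : Extendable Y (A j) T) =>
    exists_extension hU hpos hYU hYc hYf hYm hT
  let T : ℕ → Finset ℕ := fun n => Nat.rec ∅ (fun _ T => adjoin T (next T)) n
  have hT : ∀ n, T (n + 1) = adjoin (T n) (next (T n)) := fun _ => rfl
  have hgood : ∀ n, Extendable Y (A j) (T n) := fun n => by
    induction n with
    | zero => exact ⟨by simp [T], q, hqY, by simpa [T] using hj⟩
    | succ n ih => exact hnext _ ih
  refine ⟨j, fun n => next (T n), b, StrictMono.injective ?_, hb.injective, fun n i hi => ?_, hbA⟩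
  · exact strictMono_nat_of_lt_succ fun n => hlt _ (hgood (n + 1)) _ (by simp [hT n, adjoin])
  · exact (hgood (i n + 1)).1 (logTower_mem hT hi)

end ExpHindman

theorem theorem4p8 (P : Set (Set ℕ+)) (hfin : P.Finite) (hP : Setoid.IsPartition P) :
    ∃ A ∈ P, ∃ x y : ℕ → ℕ+, Function.Injective x ∧ Function.Injective y ∧
      ExpHindman.FEX x ∪ ExpHindman.FP y ⊆ A := by
  have : Finite P := hfin
  obtain ⟨⟨A, hA⟩, a, b, ha, hb, hlog, hsum⟩ := ExpHindman.exists_logTower_mem_and_sum_mem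
    (fun B : P => {n | (2 : ℕ+) ^ n ∈ B.1}) fun n => by
      obtain ⟨B, ⟨hB, hn⟩, -⟩ := hP.2 (2 ^ n)
      exact ⟨⟨B, hB⟩, hn⟩
  have hinj : Function.Injective fun n : ℕ => (2 : ℕ+) ^ n := fun m n h => by
    have h' := congrArg PNat.val h
    simp only [PNat.pow_coe] at h'
    exact Nat.pow_right_injective le_rfl h'
  refine ⟨A, hA, fun n => 2 ^ a n, fun n => 2 ^ b n, hinj.comp ha, hinj.comp hb, ?_⟩
  rintro _ (⟨n, i, hi, rfl⟩ | ⟨H, hH, rfl⟩)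
  · rw [ExpHindman.tower_two_pow fun k => a (i k)]
    exact hlog n i hi
  · rw [Finset.prod_pow_eq_pow_sum]
    exact hsum H hH
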